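/- Let $N,n,m\ge 1$, let $\Omega\subset\mathbb R^N$ be a bounded domain with $C^2$ boundary, let $\omega\subset\Omega$ be a nonempty open set with characteristic function $\chi_\omega$, and let $A\in\mathbb R^{n\times n}$, $B\in\mathbb R^{n\times m}\setminus\{0\}$. Let $\{e^{t\mathcal A}\}_{t\ge0}$ be the $C_0$-semigroup on $L^2(\Omega;\mathbb R^n)$ generated by $\mathcal A=\mathbb I_n\triangle+A$ with domain $H_0^1(\Omega;\mathbb R^n)\cap H^2(\Omega;\mathbb R^n)$. For $y_0\in L^2(\Omega;\mathbb R^n)$ and $u\in L^\infty(\mathbb R^+;L^2(\Omega;\mathbb R^m))$, where $\mathbb R^+=(0,+\infty)$, put $$y(t;y_0,u)=e^{t\mathcal A}y_0+\int_0^t e^{(t-s)\mathcal A}\chi_\omega B u(s)\,ds,\qquad t\ge 0 .$$ Let $B_1^m(0)$ be the closed unit ball of $L^2(\Omega;\mathbb R^m)$. Call $u\in L^\infty(\mathbb R^+;B_1^m(0))$ an admissible control for $y_0$ if $y(t;y_0,u)=0$ for some $t>0$, and let $$T^*_{y_0}=\inf\{\hat t>0:\ \exists\,u\in L^\infty(\mathbb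 R^+;B_1^m(0))\text{ such that } y(\hat t;y_0,u)=0\}\qquad(\inf\emptyset=+\infty).$$ Let $\mathfrak R=\{\sum_{j=0}^{n-1}A^jBv_j: v_0,\dots,v_{n-1}\in\mathbb R^m\}\subset\mathbb R^n$, $k=\dim\mathfrak R$, and $\mathfrak L=L^2(\Omega;\mathfrak R)$. A Kalman decomposition of $(A,B)$ consists of an invertible matrix $P\in\mathbb R^{n\times n}$ with $P^\top=P^{-1}$ and matrices $A_1\in\mathbb R^{k\times k}$, $A_2\in\mathbb R^{k\times(n-k)}$, $A_3\in\mathbb R^{(n-k)\times(n-k)}$, $B_1\in\mathbb R^{k\times m}$ such that $$P^{-1}\mathfrak R=\mathbb R^k\times\{0\},\quad P^{-1}AP=\begin{pmatrix}A_1&A_2\\0&A_3\end{pmatrix},\quad P^{-1}B=\begin{pmatrix}B_1\\0\end{pmatrix},\quad \operatorname{rank}(B_1,A_1B_1,\dots,A_1^{k-1}B_1)=k$$ (the blocks of size $n-k$ being absent if $k=n$). Suppose that $y_0\in L^2(\Omega;\mathbb R^n)\setminus\{0\}$ has an admissible control. Then: (i) $0<T^*_{y_0}<+\infty$; (ii)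 for every Kalman decomposition of $(A,B)$, with matrix $P$, there is a unique $\hat y_0\in L^2(\Omega;\mathbb R^k)$ such that $P^{-1}y_0=(\hat y_0,0)^\top$. In particular, $y_0\in\mathfrak L$. -/

import Mathlib

open MeasureTheory Filter Topology

noncomputable section

/-- `L²(Ω; ℝ^p)` for `Ω ⊆ ℝ^N`. -/
abbrev L2Vec {N : ℕ} (Ω : Set (EuclideanSpace ℝ (Fin N))) (p : ℕ) : Type :=
  Lp (EuclideanSpace ℝ (Fin p)) 2 (volume.restrict Ω)

/-- The scalar space `L²(Ω)`. -/
abbrev L2Scalar {N : ℕ} (Ω : Set (EuclideanSpace ℝ (Fin N))) : Type :=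
  Lp ℝ 2 (volume.restrict Ω)

/-- The boundary of `Ω` is of class `C²`: near every boundary point, `Ω` is the set where a `C²`
function with nonvanishing derivative is negative. -/
def HasC2Boundary {N : ℕ} (Ω : Set (EuclideanSpace ℝ (Fin N))) : Prop :=
  ∀ x ∈ frontier Ω, ∃ V : Set (EuclideanSpace ℝ (Fin N)), IsOpen V ∧ x ∈ V ∧
    ∃ ψ : EuclideanSpace ℝ (Fin N) → ℝ, ContDiffOn ℝ 2 ψ V ∧ fderiv ℝ ψ x ≠ 0 ∧
      Ω ∩ V = {z | z ∈ V ∧ ψ z < 0}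

/-! ### Sobolev spaces and the Dirichlet Laplacian -/

open scoped ContDiff in
/-- `φ ∈ C_c^∞(Ω)`. -/
def IsTestFunction {N : ℕ} (Ω : Set (EuclideanSpace ℝ (Fin N)))
    (φ : EuclideanSpace ℝ (Fin N) → ℝ) : Prop :=
  ContDiff ℝ ∞ φ ∧ HasCompactSupport φ ∧ tsupport φ ⊆ Ω

/-- The classical partial derivative `∂φ/∂x_i`. -/
def partialDeriv {N : ℕ} (i : Fin N) (φ : EuclideanSpace ℝ (Fin N) → ℝ)
    (x : EuclideanSpace ℝ (Fin N)) : ℝ :=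
  fderiv ℝ φ x (EuclideanSpace.single i 1)

/-- `v` is the weak partial derivative `∂u/∂x_i` in `Ω`. -/
def HasWeakPartial {N : ℕ} {Ω : Set (EuclideanSpace ℝ (Fin N))} (i : Fin N)
    (u v : L2Scalar Ω) : Prop :=
  ∀ φ : EuclideanSpace ℝ (Fin N) → ℝ, IsTestFunction Ω φ →
    ∫ x in Ω, u x * partialDeriv i φ x = -∫ x in Ω, v x * φ x

/-- `H²(Ω)`: the functions all of whose weak partial derivatives of order one and two exist and lie
in `L²(Ω)`. -/
def sobolevH2 {N : ℕ} (Ω : Set (EuclideanSpace ℝ (Fin N))) : Set (L2Scalar Ω) :=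
  {u | ∀ i : Fin N, ∃ g : L2Scalar Ω, HasWeakPartial i u g ∧
    ∀ j : Fin N, ∃ h : L2Scalar Ω, HasWeakPartial j g h}

/-- `H_0^1(Ω)`: the closure of `C_c^∞(Ω)` in the norm of `H^1(Ω)`, i.e. the first components of the
closure in `L²(Ω) × L²(Ω)^N` of the pairs `(φ, ∇φ)` with `φ ∈ C_c^∞(Ω)`. -/
def sobolevH10 {N : ℕ} (Ω : Set (EuclideanSpace ℝ (Fin N))) : Set (L2Scalar Ω) :=
  {u | ∃ g : Fin N → L2Scalar Ω, (u, g) ∈ closure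
    {q : L2Scalar Ω × (Fin N → L2Scalar Ω) |
      ∃ φ : EuclideanSpace ℝ (Fin N) → ℝ, IsTestFunction Ω φ ∧
        q.1 =ᵐ[volume.restrict Ω] φ ∧
        ∀ i, q.2 i =ᵐ[volume.restrict Ω] partialDeriv i φ}}

/-- `f = Δu = ∑ i, ∂²u/∂x_i²` in the weak sense, for `u` in the domain `H_0^1(Ω) ∩ H²(Ω)`. -/
def IsDirichletLaplacian {N : ℕ} {Ω : Set (EuclideanSpace ℝ (Fin N))}
    (u f : L2Scalar Ω) : Prop :=
  u ∈ sobolevH10 Ω ∧ u ∈ sobolevH2 Ω ∧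
    ∃ g h : Fin N → L2Scalar Ω,
      (∀ i, HasWeakPartial i u (g i) ∧ HasWeakPartial i (g i) (h i)) ∧ f = ∑ i, h i

/-! ### Matrices acting pointwise on `L²` -/

/-- The operator `y ↦ M y` from `L²(Ω; ℝ^q)` to `L²(Ω; ℝ^p)`, for a `p × q` matrix `M`. -/
def matrixOp {N p q : ℕ} (Ω : Set (EuclideanSpace ℝ (Fin N))) (M : Matrix (Fin p) (Fin q) ℝ) :
    L2Vec Ω q →L[ℝ] L2Vec Ω p :=
  (LinearMap.toContinuousLinearMap (Matrix.toEuclideanLin M)).compLpL 2 (volume.restrict Ω)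

/-- The `i`-th component of an element of `L²(Ω; ℝ^p)`. -/
def component {N p : ℕ} {Ω : Set (EuclideanSpace ℝ (Fin N))} (i : Fin p) (y : L2Vec Ω p) :
    L2Scalar Ω :=
  (EuclideanSpace.proj i : EuclideanSpace ℝ (Fin p) →L[ℝ] ℝ).compLp y

/-- The control operator `v ↦ χ_ω B v` from `L²(Ω; ℝ^m)` to `L²(Ω; ℝ^n)`. -/
def controlOp {N n m : ℕ} (Ω : Set (EuclideanSpace ℝ (Fin N)))
    {ω : Set (EuclideanSpace ℝ (Fin N))} (hω : IsOpen ω) (B : Matrix (Fin n) (Fin m) ℝ)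
    (v : L2Vec Ω m) : L2Vec Ω n :=
  ((Lp.memLp (matrixOp Ω B v)).indicator hω.measurableSet).toLp (ω.indicator (matrixOp Ω B v))

/-! ### The semigroup and the controlled system -/

/-- The graph of the operator `I_n Δ + A` on `L²(Ω; ℝ^n)`, with domain
`H_0^1(Ω; ℝ^n) ∩ H²(Ω; ℝ^n)`: `y` is in the domain and is sent to `z`. -/
def IsCoupledLaplacian {N n : ℕ} {Ω : Set (EuclideanSpace ℝ (Fin N))}
    (A : Matrix (Fin n) (Fin n) ℝ) (y z : L2Vec Ω n) : Prop :=
  ∃ w : L2Vec Ω n, (∀ i, IsDirichletLaplacian (component i y) (component i w)) ∧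
    z = w + matrixOp Ω A y

/-- `S` (at nonnegative times) is a `C₀`-semigroup on the Banach space `X`. -/
structure IsC0Semigroup {X : Type*} [NormedAddCommGroup X] [NormedSpace ℝ X]
    (S : ℝ → X →L[ℝ] X) : Prop where
  zero : S 0 = ContinuousLinearMap.id ℝ X
  add : ∀ s t : ℝ, 0 ≤ s → 0 ≤ t → S (s + t) = (S s).comp (S t)
  tendsto : ∀ x : X, Tendsto (fun t => S t x) (𝓝[>] 0) (𝓝 x)

/-- `S` is the `C₀`-semigroup generated by the operator with graph `G`: the limit of
`(S(t)y - y)/t` as `t → 0+` exists and equals `z` exactly when `G y z`. -/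
def IsGeneratedBy {X : Type*} [NormedAddCommGroup X] [NormedSpace ℝ X]
    (S : ℝ → X →L[ℝ] X) (G : X → X → Prop) : Prop :=
  IsC0Semigroup S ∧
    ∀ y z : X, G y z ↔ Tendsto (fun t : ℝ => t⁻¹ • (S t y - y)) (𝓝[>] 0) (𝓝 z)

open Classical in
/-- The semigroup `e^{t(I_n Δ + A)}`, `t ≥ 0`, on `L²(Ω; ℝ^n)`: the `C₀`-semigroup generated by
`I_n Δ + A` with domain `H_0^1(Ω; ℝ^n) ∩ H²(Ω; ℝ^n)`. For a bounded domain with `C²` boundary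
there is exactly one; the value where there is none is irrelevant. -/
def heatSemigroup {N n : ℕ} (Ω : Set (EuclideanSpace ℝ (Fin N)))
    (A : Matrix (Fin n) (Fin n) ℝ) : ℝ → L2Vec Ω n →L[ℝ] L2Vec Ω n :=
  if h : ∃ S : ℝ → L2Vec Ω n →L[ℝ] L2Vec Ω n, IsGeneratedBy S (IsCoupledLaplacian A) then
    h.choose
  else fun _ => ContinuousLinearMap.id ℝ (L2Vec Ω n)

/-- The solution `y(t; y₀, u) = e^{t𝒜} y₀ + ∫_0^t e^{(t-s)𝒜} χ_ω B u(s) ds` of the controlled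
system. -/
def heatState {N n m : ℕ} (Ω : Set (EuclideanSpace ℝ (Fin N)))
    {ω : Set (EuclideanSpace ℝ (Fin N))} (hω : IsOpen ω) (A : Matrix (Fin n) (Fin n) ℝ)
    (B : Matrix (Fin n) (Fin m) ℝ) (y₀ : L2Vec Ω n) (u : ℝ → L2Vec Ω m) (t : ℝ) : L2Vec Ω n :=
  heatSemigroup Ω A t y₀ +
    ∫ s in (0 : ℝ)..t, heatSemigroup Ω A (t - s) (controlOp Ω hω B (u s))

/-- `u ∈ L^∞(ℝ⁺; B_1^m(0))`, where `B_1^m(0)` is the closed unit ball of `L²(Ω; ℝ^m)`. -/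
def IsConstrainedControl {N m : ℕ} {Ω : Set (EuclideanSpace ℝ (Fin N))}
    (u : ℝ → L2Vec Ω m) : Prop :=
  AEStronglyMeasurable u (volume.restrict (Set.Ioi (0 : ℝ))) ∧
    ∀ᵐ t ∂(volume.restrict (Set.Ioi (0 : ℝ))), ‖u t‖ ≤ 1

/-- `u` is an admissible control: it satisfies the constraint and steers `y₀` to `0` at some
positive time. -/
def IsAdmissibleControl {N n m : ℕ} (Ω : Set (EuclideanSpace ℝ (Fin N)))
    {ω : Set (EuclideanSpace ℝ (Fin N))} (hω : IsOpen ω) (A : Matrix (Fin n) (Fin n) ℝ)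
    (B : Matrix (Fin n) (Fin m) ℝ) (y₀ : L2Vec Ω n) (u : ℝ → L2Vec Ω m) : Prop :=
  IsConstrainedControl u ∧ ∃ t : ℝ, 0 < t ∧ heatState Ω hω A B y₀ u t = 0

/-- The optimal time, in the extended reals (so it is `+∞` when there is no admissible control). -/
def optimalTime {N n m : ℕ} (Ω : Set (EuclideanSpace ℝ (Fin N)))
    {ω : Set (EuclideanSpace ℝ (Fin N))} (hω : IsOpen ω) (A : Matrix (Fin n) (Fin n) ℝ)
    (B : Matrix (Fin n) (Fin m) ℝ) (y₀ : L2Vec Ω n) : EReal :=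
  sInf ((fun t : ℝ => (t : EReal)) '' {t : ℝ | 0 < t ∧
    ∃ u : ℝ → L2Vec Ω m, IsConstrainedControl u ∧ heatState Ω hω A B y₀ u t = 0})

/-! ### The controllable subspace and the Kalman decomposition -/

/-- `ℜ = {∑_{j=0}^{n-1} A^j B v_j : v_0, …, v_{n-1} ∈ ℝ^m}`. -/
def reachableSpace {n m : ℕ} (A : Matrix (Fin n) (Fin n) ℝ) (B : Matrix (Fin n) (Fin m) ℝ) :
    Submodule ℝ (Fin n → ℝ) :=
  LinearMap.range (∑ j : Fin n,
    (A ^ (j : ℕ) * B).mulVecLin ∘ₗ (LinearMap.proj j : (Fin n → Fin m → ℝ) →ₗ[ℝ] (Fin m → ℝ)))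

/-- The controllable subspace `𝔏 = L²(Ω; ℜ)`. -/
def controllableSubspace {N n m : ℕ} (Ω : Set (EuclideanSpace ℝ (Fin N)))
    (A : Matrix (Fin n) (Fin n) ℝ) (B : Matrix (Fin n) (Fin m) ℝ) : Set (L2Vec Ω n) :=
  {y | ∀ᵐ x ∂(volume.restrict Ω), (y x).ofLp ∈ reachableSpace A B}

/-- Splitting the indices `0, …, n-1` into the first `k` and the last `n - k`. -/
def blockEquiv {k n : ℕ} (hk : k ≤ n) : Fin k ⊕ Fin (n - k) ≃ Fin n :=
  finSumFinEquiv.trans (finCongr (Nat.add_sub_of_le hk))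

/-- The Kalman controllability decomposition of `(A, B)`, with `k = dim ℜ`: an orthogonal matrix
`P` and blocks `A₁, A₂, A₃, B₁` with `P⁻¹ ℜ = ℝ^k × {0}`, `P⁻¹ A P = (A₁ A₂; 0 A₃)`,
`P⁻¹ B = (B₁; 0)` and `rank (B₁, A₁ B₁, …, A₁^{k-1} B₁) = k`. -/
structure IsKalmanDecomposition {n m k : ℕ} (hk : k ≤ n)
    (A : Matrix (Fin n) (Fin n) ℝ) (B : Matrix (Fin n) (Fin m) ℝ)
    (P : Matrix (Fin n) (Fin n) ℝ)
    (A₁ : Matrix (Fin k) (Fin k) ℝ) (A₂ : Matrix (Fin k) (Fin (n - k)) ℝ)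
    (A₃ : Matrix (Fin (n - k)) (Fin (n - k)) ℝ) (B₁ : Matrix (Fin k) (Fin m) ℝ) : Prop where
  dim_eq : k = Module.finrank ℝ (reachableSpace A B)
  isUnit : IsUnit P
  transpose_eq : P.transpose = P⁻¹
  image_eq : P⁻¹.mulVec '' (reachableSpace A B : Set (Fin n → ℝ)) =
    {x | ∀ i : Fin (n - k), x (blockEquiv hk (Sum.inr i)) = 0}
  conj_eq : P⁻¹ * A * P =
    (Matrix.fromBlocks A₁ A₂ 0 A₃).submatrix (blockEquiv hk).symm (blockEquiv hk).symm
  input_eq : P⁻¹ * B = (Matrix.fromRows B₁ 0).submatrix (blockEquiv hk).symm id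
  rank_eq : (Matrix.of fun (i : Fin k) (p : Fin k × Fin m) =>
    (A₁ ^ (p.1 : ℕ) * B₁) i p.2).rank = k

/-- The element `(ŷ, 0)` of `L²(Ω; ℝ^n)`, for `ŷ ∈ L²(Ω; ℝ^k)`. -/
def padZero {N k n : ℕ} {Ω : Set (EuclideanSpace ℝ (Fin N))} (hk : k ≤ n) (y : L2Vec Ω k) :
    L2Vec Ω n :=
  matrixOp Ω ((Matrix.fromRows (1 : Matrix (Fin k) (Fin k) ℝ) 0).submatrix
    (blockEquiv hk).symm id) y

end

/-!
Write `S(t)` for the semigroup `e^{t𝒜}`, `𝐀` for the bounded operator `y ↦ A y` on `L²(Ω; ℝ^n)`,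
`ℜ` for the reachable space and `𝔏 = L²(Ω; ℜ)`. If `u` steers `y₀` to `0` at time `t`, then
`S(t) y₀ = -∫₀ᵗ S(t - s) χ_ω B u(s) ds`. The central fact is that the free evolution neither enters
nor leaves `𝔏`: for `t ≥ 0`, `S(t) y ∈ 𝔏 ↔ y ∈ 𝔏` (`heatSemigroup_mem_controllableSubspace_iff`).
Since `χ_ω B u(s) ∈ 𝔏` and `𝔏` is the kernel of a bounded operator, the integral is in `𝔏`, hence so
is `S(t) y₀`, hence so is `y₀`. The coordinates of `P⁻¹ y₀` in a Kalman decomposition are then read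
off pointwise.

The direction `S(t) y ∈ 𝔏 → y ∈ 𝔏` is a backward uniqueness statement. Multiplication by a constant
matrix commutes with the componentwise Laplacian, so `T(t) = e^{-t𝐀} S(t)` is the semigroup
generated by the componentwise Dirichlet Laplacian alone (`IsGeneratedBy.exp_neg_smul_comp`). It
commutes with all constant matrices (`IsGeneratedBy.apply_comm`), in particular with a matrix `Q`
whose kernel is `ℜ`, and it is symmetric (`IsGeneratedBy.inner_apply_comm`) because the Dirichlet
Laplacian is, by Green's identity (`IsDirichletLaplacian.inner_comm`). A symmetric `C₀`-semigroup is
injective at every time (`IsC0Semigroup.eq_zero_of_apply_eq_zero`), so `Q T(t) y = T(t) Q y = 0`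
forces `Q y = 0`. The factor `e^{t𝐀}` is harmless: it maps `𝔏` into itself because, by
Cayley–Hamilton, `A ℜ ⊆ ℜ`.

The optimal time is positive because `S(t) y₀ → y₀ ≠ 0` as `t → 0+`, while a constrained control
moves the state by at most a multiple of `t` (`exists_pos_forall_heatState_ne_zero`).

No elliptic regularity is needed: the argument works with whatever `C₀`-semigroup is generated by
`I_n Δ + A`. The definition of `heatSemigroup` takes the constant identity if there is none; that
family trivially satisfies the same equivalence (`heatSemigroup_cases`).
-/

/-! ### `C₀`-semigroups and their generators -/

section Semigroup

variable {X : Type*} [NormedAddCommGroup X] [NormedSpace ℝ X]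

theorem hasDerivWithinAt_Ici_of_tendsto {f : ℝ → X} {x : ℝ} {f' : X}
    (h : Tendsto (fun t : ℝ => t⁻¹ • (f (x + t) - f x)) (𝓝[>] 0) (𝓝 f')) :
    HasDerivWithinAt f f' (Set.Ici x) x := by
  rw [← hasDerivWithinAt_Ioi_iff_Ici, hasDerivWithinAt_iff_tendsto_slope' (by simp)]
  have hmap : Tendsto (fun s : ℝ => s - x) (𝓝[>] x) (𝓝[>] 0) := by
    refine tendsto_nhdsWithin_iff.2 ⟨?_, ?_⟩
    · have : Tendsto (fun s : ℝ => s - x) (𝓝 x) (𝓝 (x - x)) := tendsto_id.sub_const x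
      rw [sub_self] at this
      exact this.mono_left nhdsWithin_le_nhds
    · filter_upwards [self_mem_nhdsWithin] with s hs
      simpa using hs
  refine (h.comp hmap).congr fun s => ?_
  simp [slope_def_module]

namespace IsC0Semigroup

variable {S : ℝ → X →L[ℝ] X}

theorem tendsto_nhdsGE (hS : IsC0Semigroup S) (x : X) :
    Tendsto (fun t => S t x) (𝓝[≥] 0) (𝓝 x) := by
  have h : ContinuousWithinAt (fun t => S t x) (Set.Ioi 0) 0 := by
    simpa [ContinuousWithinAt, hS.zero] using hS.tendsto x
  rw [continuousWithinAt_Ioi_iff_Ici] at h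
  simpa [ContinuousWithinAt, hS.zero] using h

/-- Uniform boundedness principle along a sequence of times tending to `0`. -/
theorem exists_norm_le_near_zero [CompleteSpace X] (hS : IsC0Semigroup S) :
    ∃ δ > 0, ∃ C, ∀ t ∈ Set.Icc 0 δ, ‖S t‖ ≤ C := by
  by_contra! hcon
  choose t ht hnorm using fun n : ℕ =>
    hcon (1 / ((n : ℝ) + 1)) Nat.one_div_pos_of_nat (n : ℝ)
  have htend : Tendsto t atTop (𝓝[≥] 0) := by
    refine tendsto_nhdsWithin_iff.2 ⟨?_, Eventually.of_forall fun n => (ht n).1⟩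
    exact squeeze_zero (fun n => (ht n).1) (fun n => (ht n).2)
      tendsto_one_div_add_atTop_nhds_zero_nat
  obtain ⟨C, hC⟩ := banach_steinhaus (g := fun n => S (t n)) fun x => by
    obtain ⟨C, hC⟩ := (((hS.tendsto_nhdsGE x).comp htend).norm).bddAbove_range
    exact ⟨C, fun n => hC ⟨n, rfl⟩⟩
  obtain ⟨n, hn⟩ := exists_nat_gt C
  exact absurd (hC n) (not_le.2 (hn.trans (hnorm n)))

theorem exists_norm_le [CompleteSpace X] (hS : IsC0Semigroup S) (τ : ℝ) :
    ∃ C, ∀ t ∈ Set.Icc 0 τ, ‖S t‖ ≤ C := by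
  obtain ⟨δ, hδ, C, hC⟩ := hS.exists_norm_le_near_zero
  have key : ∀ n : ℕ, ∃ K, ∀ t ∈ Set.Icc 0 (n * δ), ‖S t‖ ≤ K := by
    intro n
    induction n with
    | zero =>
      refine ⟨‖S 0‖, fun t ht => ?_⟩
      have : t = 0 := le_antisymm (by simpa using ht.2) ht.1
      rw [this]
    | succ n ih =>
      obtain ⟨K, hK⟩ := ih
      refine ⟨max C (C * K), fun t ht => ?_⟩
      rcases le_total t δ with h | h
      · exact (hC t ⟨ht.1, h⟩).trans (le_max_left _ _)
      · have ht2 := ht.2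
        push_cast at ht2
        have e : S t = (S δ).comp (S (t - δ)) := by
          rw [← hS.add δ (t - δ) hδ.le (by linarith)]
          congr 1
          ring
        rw [e]
        refine ((S δ).opNorm_comp_le _).trans (le_trans ?_ (le_max_right _ _))
        have hδC := hC δ ⟨hδ.le, le_rfl⟩
        exact mul_le_mul hδC (hK _ ⟨by linarith, by linarith⟩) (norm_nonneg _)
          ((norm_nonneg _).trans hδC)
  obtain ⟨n, hn⟩ := exists_nat_gt (τ / δ)
  obtain ⟨K, hK⟩ := key n
  rw [div_lt_iff₀ hδ] at hn
  exact ⟨K, fun t ht => hK t ⟨ht.1, ht.2.trans hn.le⟩⟩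

theorem apply_add (hS : IsC0Semigroup S) {s t : ℝ} (hs : 0 ≤ s) (ht : 0 ≤ t) (x : X) :
    S (s + t) x = S s (S t x) := by
  rw [hS.add s t hs ht]; rfl

/-- Joint continuity of `(t, x) ↦ S t x` on `[0, ∞) × X`. -/
theorem tendsto_apply [CompleteSpace X] (hS : IsC0Semigroup S) {ι : Type*} {l : Filter ι}
    {a : ι → ℝ} {g : ι → X} {t : ℝ} {x : X} (ht : 0 ≤ t) (ha : Tendsto a l (𝓝 t))
    (ha0 : ∀ᶠ i in l, 0 ≤ a i) (hg : Tendsto g l (𝓝 x)) :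
    Tendsto (fun i => S (a i) (g i)) l (𝓝 (S t x)) := by
  obtain ⟨C, hC⟩ := hS.exists_norm_le (t + 1)
  have habs : Tendsto (fun i => |a i - t|) l (𝓝[≥] 0) := by
    refine tendsto_nhdsWithin_iff.2 ⟨?_, Eventually.of_forall fun i => abs_nonneg (a i - t)⟩
    simpa using (ha.sub_const t).abs
  have h1 : Tendsto (fun i => C * (‖g i - x‖ + ‖S |a i - t| x - x‖)) l (𝓝 0) := by
    have e1 : Tendsto (fun i => ‖g i - x‖) l (𝓝 0) := by
      simpa using (hg.sub_const x).norm
    have e2 : Tendsto (fun i => ‖S |a i - t| x - x‖) l (𝓝 0) := by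
      simpa using ((((hS.tendsto_nhdsGE x).comp habs).sub_const x).norm)
    simpa using (e1.add e2).const_mul C
  rw [tendsto_iff_norm_sub_tendsto_zero]
  refine squeeze_zero' (Eventually.of_forall fun i => norm_nonneg _) ?_ h1
  filter_upwards [ha0, ha.eventually (gt_mem_nhds (show t < t + 1 by linarith))] with i hi0 hi1
  have b1 : ‖S (a i) (g i - x)‖ ≤ C * ‖g i - x‖ :=
    (S (a i)).le_of_opNorm_le (hC _ ⟨hi0, hi1.le⟩) _
  have b2 : ‖S (a i) x - S t x‖ ≤ C * ‖S |a i - t| x - x‖ := by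
    rcases le_total t (a i) with h | h
    · have e : S (a i) x - S t x = S t (S |a i - t| x - x) := by
        rw [map_sub, ← hS.apply_add ht (abs_nonneg _), abs_of_nonneg (by linarith)]
        congr 3
        ring
      rw [e]
      exact (S t).le_of_opNorm_le (hC _ ⟨ht, by linarith⟩) _
    · have e : S (a i) x - S t x = -S (a i) (S |a i - t| x - x) := by
        rw [map_sub, ← hS.apply_add hi0 (abs_nonneg _), abs_of_nonpos (by linarith), neg_sub]
        congr 3
        ring
      rw [e, norm_neg]
      exact (S (a i)).le_of_opNorm_le (hC _ ⟨hi0, hi1.le⟩) _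
  calc ‖S (a i) (g i) - S t x‖ = ‖S (a i) (g i - x) + (S (a i) x - S t x)‖ := by
        rw [map_sub]; congr 1; abel
    _ ≤ C * ‖g i - x‖ + C * ‖S |a i - t| x - x‖ := (norm_add_le _ _).trans (add_le_add b1 b2)
    _ = _ := by ring

theorem continuousOn_orbit [CompleteSpace X] (hS : IsC0Semigroup S) (x : X) :
    ContinuousOn (fun t => S t x) (Set.Ici 0) := fun _ ht =>
  hS.tendsto_apply ht (tendsto_id.mono_left nhdsWithin_le_nhds) self_mem_nhdsWithin
    tendsto_const_nhds

end IsC0Semigroup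

namespace IsGeneratedBy

variable {S : ℝ → X →L[ℝ] X} {G : X → X → Prop}

theorem graph_apply (hS : IsGeneratedBy S G) {y z : X} (h : G y z) {t : ℝ} (ht : 0 ≤ t) :
    G (S t y) (S t z) := by
  rw [hS.2]
  have h1 := ((S t).continuous.tendsto z).comp ((hS.2 y z).1 h)
  refine h1.congr' ?_
  filter_upwards [self_mem_nhdsWithin] with s hs
  have hs : 0 ≤ s := le_of_lt hs
  simp only [Function.comp_apply, map_smul, map_sub]
  rw [← hS.1.apply_add ht hs, ← hS.1.apply_add hs ht, add_comm]

/-- The averages `h⁻¹ ∫₀ʰ S r x dr` lie in the domain of the generator and tend to `x`. -/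
theorem dense_domain [CompleteSpace X] (hS : IsGeneratedBy S G) : Dense {y | ∃ z, G y z} := by
  intro x
  -- Extending the orbit by its value at `0` makes it continuous on the whole line.
  set c : ℝ → X := fun r => S (max r 0) x with hc
  have hcont : Continuous c := (hS.1.continuousOn_orbit x).comp_continuous (by fun_prop) (by simp)
  set F : ℝ → X := fun h => ∫ r in (0 : ℝ)..h, c r with hF
  have hder : ∀ h, HasDerivAt F (c h) h := fun h =>
    hcont.integral_hasStrictDerivAt 0 h |>.hasDerivAt
  have hc0 : c 0 = x := by simp [hc, hS.1.zero]
  have hderiv : ∀ h, Tendsto (fun t : ℝ => t⁻¹ • (F (h + t) - F h)) (𝓝[>] 0) (𝓝 (c h)) := fun h =>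
    (hder h).tendsto_slope_zero_right
  have hF0 : F 0 = 0 := by simp [hF]
  refine mem_closure_of_tendsto (f := fun t : ℝ => t⁻¹ • F t) (b := 𝓝[>] 0) ?_ ?_
  · simpa [hF0, hc0] using hderiv 0
  · filter_upwards [self_mem_nhdsWithin] with h hh
    have hh : 0 < h := hh
    refine ⟨h⁻¹ • (c h - c 0), ?_⟩
    rw [hS.2]
    have h1 := ((hderiv h).sub (hderiv 0)).const_smul h⁻¹
    refine h1.congr' ?_
    filter_upwards [self_mem_nhdsWithin] with t ht
    have ht : 0 < t := ht
    have e1 : S t (F h) = F (t + h) - F t := by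
      simp only [hF]
      rw [← ContinuousLinearMap.intervalIntegral_comp_comm _ (hcont.intervalIntegrable _ _),
        intervalIntegral.integral_interval_sub_left (hcont.intervalIntegrable _ _)
          (hcont.intervalIntegrable _ _)]
      have e2 := intervalIntegral.integral_comp_add_left (a := 0) (b := h) c t
      rw [add_zero] at e2
      rw [← e2]
      refine intervalIntegral.integral_congr fun r hr => ?_
      rw [Set.uIcc_of_le hh.le] at hr
      simp only [hc]
      rw [max_eq_left hr.1, max_eq_left (add_nonneg ht.le hr.1), hS.1.apply_add ht.le hr.1]
    simp only [map_smul, e1, hF0, zero_add, sub_zero, add_comm h t]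
    module

/-- A bounded operator that preserves the graph of the generator commutes with the semigroup:
`s ↦ S (t - s) (L (S s y))` has right derivative `0`. -/
theorem apply_comm [CompleteSpace X] (hS : IsGeneratedBy S G) {L : X →L[ℝ] X}
    (hL : ∀ y z, G y z → G (L y) (L z)) {t : ℝ} (ht : 0 ≤ t) (x : X) :
    S t (L x) = L (S t x) := by
  refine congrFun (Continuous.ext_on hS.dense_domain
    (f := fun x => S t (L x)) (g := fun x => L (S t x)) (by fun_prop) (by fun_prop) ?_) x
  rintro y ⟨z, hyz⟩
  have key := constant_of_has_deriv_right_zero (f := fun s => S (t - s) (L (S s y)))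
    (a := 0) (b := t) ?_ ?_ t ⟨ht, le_rfl⟩
  · simpa [hS.1.zero] using key.symm
  · intro s hs
    refine hS.1.tendsto_apply (sub_nonneg.2 hs.2)
      ((tendsto_id.mono_left nhdsWithin_le_nhds).const_sub t) ?_ ?_
    · filter_upwards [self_mem_nhdsWithin] with r hr
      exact sub_nonneg.2 hr.2
    · exact (L.continuous.tendsto _).comp
        ((hS.1.continuousOn_orbit y s hs.1).mono_left (nhdsWithin_mono _ fun r hr => hr.1))
  · intro s hs
    refine hasDerivWithinAt_Ici_of_tendsto ?_
    have hv := hS.graph_apply hyz hs.1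
    have h1 := ((L.continuous.tendsto _).comp ((hS.2 _ _).1 hv)).sub ((hS.2 _ _).1 (hL _ _ hv))
    rw [sub_self] at h1
    have ha : Tendsto (fun h : ℝ => t - (s + h)) (𝓝[>] 0) (𝓝 (t - s)) := by
      have : Tendsto (fun h : ℝ => t - (s + h)) (𝓝 0) (𝓝 (t - (s + 0))) :=
        (tendsto_id.const_add s).const_sub t
      rw [add_zero] at this
      exact this.mono_left nhdsWithin_le_nhds
    have hpos : ∀ᶠ h : ℝ in 𝓝[>] 0, 0 ≤ t - (s + h) := by
      filter_upwards [ha.eventually (lt_mem_nhds (sub_pos.2 hs.2))] with h hh using hh.le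
    have h2 := hS.1.tendsto_apply (sub_nonneg.2 hs.2.le) ha hpos h1
    rw [map_zero] at h2
    refine h2.congr' ?_
    filter_upwards [self_mem_nhdsWithin, hpos] with h hh hh2
    have hh : 0 ≤ h := le_of_lt hh
    have e1 : S (s + h) y = S h (S s y) := by rw [add_comm, hS.1.apply_add hh hs.1]
    have e2 : S (t - s) (L (S s y)) = S (t - (s + h)) (S h (L (S s y))) := by
      rw [← hS.1.apply_add hh2 hh]
      congr 2
      ring
    simp only [Function.comp_apply, map_smul, map_sub, e1, e2]
    module

end IsGeneratedBy

theorem Filter.Tendsto.continuousLinearMap_apply {ι : Type*} {l : Filter ι} {F : ι → X →L[ℝ] X}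
    {g : ι → X} {L : X →L[ℝ] X} {x : X} (hF : Tendsto F l (𝓝 L)) (hg : Tendsto g l (𝓝 x)) :
    Tendsto (fun i => F i (g i)) l (𝓝 (L x)) :=
  (isBoundedBilinearMap_apply.continuous.tendsto (L, x)).comp (hF.prodMk_nhds hg)

/-- Multiplying a family by operators with derivative `K` at `0` adds `K y` to the right
derivative at `0`. -/
theorem tendsto_quotient_comp {S F : ℝ → X →L[ℝ] X} {K : X →L[ℝ] X} (hF0 : F 0 = 1)
    (hF : HasDerivAt F K 0) {y z : X}
    (h : Tendsto (fun t : ℝ => t⁻¹ • (S t y - y)) (𝓝[>] 0) (𝓝 z)) :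
    Tendsto (fun t : ℝ => t⁻¹ • (F t (S t y) - y)) (𝓝[>] 0) (𝓝 (z + K y)) := by
  have h1 : Tendsto F (𝓝[>] 0) (𝓝 1) := by
    rw [← hF0]
    exact hF.continuousAt.tendsto.mono_left nhdsWithin_le_nhds
  have h2 := hF.tendsto_slope_zero_right
  have h3 := h1.continuousLinearMap_apply h
  have h4 := h2.continuousLinearMap_apply (tendsto_const_nhds (x := y))
  refine (h3.add h4).congr fun t => ?_
  simp [hF0]
  module

open NormedSpace in
/-- If `S` is generated by `G + 𝐀` and the bounded operator `𝐀` commutes with `G`, then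
`exp (-t 𝐀) S(t)` is the semigroup generated by `G`. -/
theorem IsGeneratedBy.exp_neg_smul_comp [CompleteSpace X] {S : ℝ → X →L[ℝ] X} {G : X → X → Prop}
    {K : X →L[ℝ] X} (hS : IsGeneratedBy S fun y z => G y (z - K y))
    (hK : ∀ y z, G y z → G (K y) (K z)) :
    IsGeneratedBy (fun t => (exp (-t • K)).comp (S t)) G := by
  have hcomm : ∀ t, 0 ≤ t → Commute (S t) K := fun t ht => ContinuousLinearMap.ext fun x =>
    hS.apply_comm (fun y z h => by rw [← map_sub]; exact hK _ _ h) ht x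
  have hder : ∀ c : ℝ, HasDerivAt (fun t : ℝ => exp (t • (c • K))) (c • K) 0 := fun c => by
    have h := hasDerivAt_exp_smul_const (𝕂 := ℝ) (c • K) (0 : ℝ)
    rwa [zero_smul, exp_zero, one_mul] at h
  let _ : NormedAlgebra ℚ (X →L[ℝ] X) := NormedAlgebra.restrictScalars ℚ ℝ (X →L[ℝ] X)
  have hneg : HasDerivAt (fun t : ℝ => exp (-t • K)) ((-1 : ℝ) • K) 0 := by
    convert hder (-1) using 3 with t
    module
  have e3 : ∀ t : ℝ, exp (t • K) * exp (-t • K) = 1 := fun t => by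
    rw [← exp_add_of_commute]
    · simp
    · exact ((Commute.refl K).smul_left _).smul_right _
  refine ⟨⟨?_, ?_, ?_⟩, ?_⟩
  · rw [neg_zero, zero_smul, exp_zero, hS.1.zero]
    rfl
  · intro s t hs ht
    have h1 : exp (-(s + t) • K) = exp (-s • K) * exp (-t • K) := by
      rw [← exp_add_of_commute]
      · congr 1; module
      · exact ((Commute.refl K).smul_left _).smul_right _
    have h2 : S s * exp (-t • K) = exp (-t • K) * S s :=
      ((hcomm s hs).smul_right (-t)).exp_right
    change exp (-(s + t) • K) * S (s + t) = (exp (-s • K) * S s) * (exp (-t • K) * S t)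
    rw [h1, hS.1.add s t hs ht]
    change _ * (S s * S t) = _
    rw [mul_assoc, mul_assoc, ← mul_assoc (S s), h2, mul_assoc]
  · intro x
    have h1 : Tendsto (fun t : ℝ => exp (-t • K)) (𝓝[>] 0) (𝓝 1) := by
      have := hneg.continuousAt.tendsto
      rw [neg_zero, zero_smul, exp_zero] at this
      exact this.mono_left nhdsWithin_le_nhds
    exact h1.continuousLinearMap_apply (hS.1.tendsto x)
  · intro y z
    have hS2 := hS.2 y (z + K y)
    simp only [add_sub_cancel_right] at hS2
    rw [hS2]
    constructor
    · intro h
      have := tendsto_quotient_comp (F := fun t => exp (-t • K)) (K := (-1 : ℝ) • K)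
        (by simp) hneg h
      simpa using this
    · intro h
      have := tendsto_quotient_comp (F := fun t : ℝ => exp (t • K)) (K := K)
        (by simp) (by simpa using hder 1) h
      refine this.congr fun t => ?_
      have e4 : exp (t • K) (exp (-t • K) (S t y)) = S t y :=
        congrArg (fun L : X →L[ℝ] X => L (S t y)) (e3 t)
      simp only [ContinuousLinearMap.comp_apply, e4]

end Semigroup

/-! ### Semigroups with symmetric generator -/

section Symmetric

variable {X : Type*} [NormedAddCommGroup X] [InnerProductSpace ℝ X]
  {S : ℝ → X →L[ℝ] X} {G : X → X → Prop}

open scoped RealInnerProductSpace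

/-- A semigroup with symmetric generator is symmetric: `s ↦ ⟪S (t - s) x, S s y⟫` has right
derivative `0`. -/
theorem IsGeneratedBy.inner_apply_comm [CompleteSpace X] (hS : IsGeneratedBy S G)
    (hG : ∀ x x' y y', G x x' → G y y' → ⟪x', y⟫ = ⟪x, y'⟫) {t : ℝ} (ht : 0 ≤ t) (x y : X) :
    ⟪S t x, y⟫ = ⟪x, S t y⟫ := by
  suffices H : ∀ x ∈ {x | ∃ z, G x z}, ∀ y ∈ {y | ∃ z, G y z}, ⟪S t x, y⟫ = ⟪x, S t y⟫ by
    have H2 : ∀ x ∈ {x | ∃ z, G x z}, ∀ y, ⟪S t x, y⟫ = ⟪x, S t y⟫ := fun x hx =>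
      congrFun (Continuous.ext_on hS.dense_domain (by fun_prop) (by fun_prop) (H x hx))
    exact congrFun (Continuous.ext_on hS.dense_domain (f := fun x => ⟪S t x, y⟫)
      (g := fun x => ⟪x, S t y⟫) (by fun_prop) (by fun_prop) fun x hx => H2 x hx y) x
  rintro x ⟨x', hx⟩ y ⟨y', hy⟩
  have key := constant_of_has_deriv_right_zero (f := fun s => ⟪S (t - s) x, S s y⟫)
    (a := 0) (b := t) ?_ ?_ t ⟨ht, le_rfl⟩
  · simpa [hS.1.zero] using key.symm
  · refine ContinuousOn.inner ?_ ?_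
    · exact (hS.1.continuousOn_orbit x).comp (by fun_prop) fun s hs => sub_nonneg.2 hs.2
    · exact (hS.1.continuousOn_orbit y).mono fun s hs => hs.1
  · intro s hs
    refine hasDerivWithinAt_Ici_of_tendsto ?_
    have hv := hS.graph_apply hy hs.1
    have hw := hS.graph_apply hx (sub_nonneg.2 hs.2.le)
    have ha : Tendsto (fun h : ℝ => t - (s + h)) (𝓝[>] 0) (𝓝 (t - s)) := by
      have : Tendsto (fun h : ℝ => t - (s + h)) (𝓝 0) (𝓝 (t - (s + 0))) :=
        (tendsto_id.const_add s).const_sub t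
      rw [add_zero] at this
      exact this.mono_left nhdsWithin_le_nhds
    have hpos : ∀ᶠ h : ℝ in 𝓝[>] 0, 0 ≤ t - (s + h) := by
      filter_upwards [ha.eventually (lt_mem_nhds (sub_pos.2 hs.2))] with h hh using hh.le
    have h1 := (hS.1.tendsto_apply (sub_nonneg.2 hs.2.le) ha hpos
      (tendsto_const_nhds (x := x))).inner (𝕜 := ℝ) ((hS.2 _ _).1 hv)
    have h2 := (hS.1.tendsto_apply (sub_nonneg.2 hs.2.le) ha hpos
      ((hS.2 _ _).1 hx)).inner (𝕜 := ℝ) (tendsto_const_nhds (x := S s y))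
    have h3 := h1.sub h2
    rw [hG _ _ _ _ hw hv, sub_self] at h3
    refine h3.congr' ?_
    filter_upwards [self_mem_nhdsWithin, hpos] with h hh hh2
    have hh : 0 ≤ h := le_of_lt hh
    have e1 : S (s + h) y = S h (S s y) := by rw [add_comm, hS.1.apply_add hh hs.1]
    have e2 : S (t - s) x = S (t - (s + h)) (S h x) := by
      rw [← hS.1.apply_add hh2 hh]
      congr 2
      ring
    simp only [map_smul, map_sub, e1, e2, inner_smul_left, inner_smul_right, inner_sub_left,
      inner_sub_right, smul_eq_mul, RCLike.conj_to_real]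
    ring

/-- Backward uniqueness for a symmetric semigroup: `‖S (t / 2) x‖² = ⟪S t x, x⟫`, so a vector
killed at time `t` is killed at the times `t / 2 ^ j`, which tend to `0`. -/
theorem IsC0Semigroup.eq_zero_of_apply_eq_zero (hS : IsC0Semigroup S)
    (hsymm : ∀ t, 0 ≤ t → ∀ x y, ⟪S t x, y⟫ = ⟪x, S t y⟫) {t : ℝ} (ht : 0 < t) {x : X}
    (hx : S t x = 0) : x = 0 := by
  have h : ∀ j : ℕ, S (t * (1 / 2) ^ j) x = 0 := by
    intro j
    induction j with
    | zero => simpa using hx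
    | succ j ih =>
      have hp : 0 ≤ t * (1 / 2) ^ (j + 1) := by positivity
      rw [← inner_self_eq_zero (𝕜 := ℝ), ← hsymm _ hp, ← hS.apply_add hp hp]
      have : t * (1 / 2 : ℝ) ^ (j + 1) + t * (1 / 2) ^ (j + 1) = t * (1 / 2) ^ j := by
        rw [pow_succ]; ring
      rw [this, ih, inner_zero_left]
  have hlim : Tendsto (fun j : ℕ => t * (1 / 2 : ℝ) ^ j) atTop (𝓝[>] 0) := by
    refine tendsto_nhdsWithin_iff.2 ⟨?_, Eventually.of_forall fun j => by
      simp only [Set.mem_Ioi]; positivity⟩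
    simpa using (tendsto_pow_atTop_nhds_zero_of_lt_one (r := (1 / 2 : ℝ))
      (by norm_num) (by norm_num)).const_mul t
  have := (hS.tendsto x).comp hlim
  refine tendsto_nhds_unique this (tendsto_const_nhds.congr fun j => (h j).symm)

end Symmetric

/-! ### Symmetry of the Dirichlet Laplacian -/

section Sobolev

open scoped RealInnerProductSpace

open scoped ContDiff

variable {N : ℕ} {Ω : Set (EuclideanSpace ℝ (Fin N))}

namespace IsTestFunction

variable {φ ψ : EuclideanSpace ℝ (Fin N) → ℝ}

theorem memLp (h : IsTestFunction Ω φ) : MemLp φ 2 (volume.restrict Ω) :=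
  (h.1.continuous.memLp_of_hasCompactSupport h.2.1).restrict Ω

theorem partialDeriv (h : IsTestFunction Ω φ) (i : Fin N) :
    IsTestFunction Ω (partialDeriv i φ) := by
  have hsupp : tsupport (_root_.partialDeriv i φ) ⊆ tsupport φ :=
    closure_minimal ((Function.support_subset_iff'.2 fun x hx => by
      have : x ∉ tsupport (fderiv ℝ φ) := fun h => hx (tsupport_fderiv_subset ℝ h)
      simp [_root_.partialDeriv, image_eq_zero_of_notMem_tsupport this])) (isClosed_tsupport φ)
  refine ⟨?_, h.2.1.mono' (subset_closure.trans hsupp), hsupp.trans h.2.2⟩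
  exact (h.1.fderiv_right (m := ∞) (by simp)).clm_apply contDiff_const

theorem zero : IsTestFunction Ω (0 : EuclideanSpace ℝ (Fin N) → ℝ) :=
  ⟨contDiff_const, HasCompactSupport.zero, by simp [tsupport]⟩

theorem add (hφ : IsTestFunction Ω φ) (hψ : IsTestFunction Ω ψ) : IsTestFunction Ω (φ + ψ) :=
  ⟨hφ.1.add hψ.1, hφ.2.1.add hψ.2.1, (tsupport_add φ ψ).trans (Set.union_subset hφ.2.2 hψ.2.2)⟩

theorem smul (c : ℝ) (hφ : IsTestFunction Ω φ) : IsTestFunction Ω (c • φ) :=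
  ⟨hφ.1.const_smul c, hφ.2.1.smul_left (f := fun _ => c),
    (tsupport_smul_subset_right (fun _ => c) φ).trans hφ.2.2⟩

theorem integral_mul_partialDeriv (hφ : IsTestFunction Ω φ) (hψ : IsTestFunction Ω ψ)
    (i : Fin N) :
    ∫ x in Ω, φ x * _root_.partialDeriv i ψ x = -∫ x in Ω, _root_.partialDeriv i φ x * ψ x := by
  have hz : ∀ x ∉ Ω, φ x = 0 := fun x hx =>
    image_eq_zero_of_notMem_tsupport fun h => hx (hφ.2.2 h)
  have hz' : ∀ x ∉ Ω, ψ x = 0 := fun x hx =>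
    image_eq_zero_of_notMem_tsupport fun h => hx (hψ.2.2 h)
  rw [setIntegral_eq_integral_of_forall_compl_eq_zero fun x hx => by rw [hz x hx, zero_mul],
    setIntegral_eq_integral_of_forall_compl_eq_zero fun x hx => by rw [hz' x hx, mul_zero]]
  refine integral_mul_fderiv_eq_neg_fderiv_mul_of_integrable ?_ ?_ ?_
    (fun x _ => hφ.1.differentiable (by simp) x) (fun x _ => hψ.1.differentiable (by simp) x)
  · exact ((hφ.partialDeriv i).1.continuous.mul hψ.1.continuous).integrable_of_hasCompactSupport
      hψ.2.1.mul_left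
  · exact (hφ.1.continuous.mul (hψ.partialDeriv i).1.continuous).integrable_of_hasCompactSupport
      hφ.2.1.mul_right
  · exact (hφ.1.continuous.mul hψ.1.continuous).integrable_of_hasCompactSupport hφ.2.1.mul_right

end IsTestFunction

theorem L2Scalar.inner_eq_integral {u v : L2Scalar Ω} {φ : EuclideanSpace ℝ (Fin N) → ℝ}
    (h : v =ᵐ[volume.restrict Ω] φ) : ⟪u, v⟫ = ∫ x in Ω, u x * φ x := by
  rw [L2.inner_def]
  refine integral_congr_ae ?_
  filter_upwards [h] with x hx
  simp [hx, mul_comm]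

theorem HasWeakPartial.inner_eq {i : Fin N} {u v p q : L2Scalar Ω} (h : HasWeakPartial i u v)
    {φ : EuclideanSpace ℝ (Fin N) → ℝ} (hφ : IsTestFunction Ω φ)
    (hp : p =ᵐ[volume.restrict Ω] φ) (hq : q =ᵐ[volume.restrict Ω] partialDeriv i φ) :
    ⟪u, q⟫ = -⟪v, p⟫ := by
  rw [L2Scalar.inner_eq_integral hp, L2Scalar.inner_eq_integral hq, h φ hφ]

/-- Weak differentiation in terms of the inner product of `L²(Ω)`. -/
theorem hasWeakPartial_iff {i : Fin N} {u v : L2Scalar Ω} :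
    HasWeakPartial i u v ↔ ∀ φ, ∀ h : IsTestFunction Ω φ,
      ⟪u, (h.partialDeriv i).memLp.toLp⟫ = -⟪v, h.memLp.toLp⟫ := by
  refine ⟨fun H φ h => H.inner_eq h (MemLp.coeFn_toLp _) (MemLp.coeFn_toLp _), fun H φ h => ?_⟩
  rw [← L2Scalar.inner_eq_integral (MemLp.coeFn_toLp h.memLp),
    ← L2Scalar.inner_eq_integral (MemLp.coeFn_toLp (h.partialDeriv i).memLp), H φ h]

namespace HasWeakPartial

variable {i : Fin N} {u u' v v' : L2Scalar Ω}

theorem zero : HasWeakPartial i (0 : L2Scalar Ω) 0 := by simp [hasWeakPartial_iff]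

theorem add (h : HasWeakPartial i u v) (h' : HasWeakPartial i u' v') :
    HasWeakPartial i (u + u') (v + v') := by
  rw [hasWeakPartial_iff] at *
  intro φ hφ
  rw [inner_add_left, inner_add_left, h φ hφ, h' φ hφ, neg_add]

theorem smul (c : ℝ) (h : HasWeakPartial i u v) : HasWeakPartial i (c • u) (c • v) := by
  rw [hasWeakPartial_iff] at *
  intro φ hφ
  rw [real_inner_smul_left, real_inner_smul_left, h φ hφ, mul_neg]

theorem unique (hΩ : IsOpen Ω) (h : HasWeakPartial i u v) (h' : HasWeakPartial i u v') :
    v = v' := by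
  have hz : HasWeakPartial i 0 (v - v') := by
    simpa [sub_eq_add_neg] using h.add (h'.smul (-1))
  rw [← sub_eq_zero]
  have key := hΩ.ae_eq_zero_of_integral_contDiff_smul_eq_zero (f := (v - v' : L2Scalar Ω))
    (μ := volume.restrict Ω)
    (((Lp.memLp (v - v')).locallyIntegrable (by norm_num)).locallyIntegrableOn Ω)
    fun φ h1 h2 h3 => by
      have h4 : IsTestFunction Ω φ := ⟨h1, h2, h3⟩
      have h5 := hasWeakPartial_iff.1 hz φ h4
      rw [inner_zero_left, eq_comm, neg_eq_zero,
        L2Scalar.inner_eq_integral (MemLp.coeFn_toLp h4.memLp)] at h5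
      simpa [mul_comm] using h5
  refine Lp.ext ?_
  filter_upwards [key, ae_restrict_mem hΩ.measurableSet, Lp.coeFn_zero ℝ 2 (volume.restrict Ω)]
    with x hx hxΩ h0
  rw [hx hxΩ, h0, Pi.zero_apply]

end HasWeakPartial

/-- The smooth compactly supported functions on `Ω` together with their gradients, in
`L²(Ω) × L²(Ω)^N`; the space `H_0^1(Ω)` is the first projection of its closure. -/
def testGradientPairs (Ω : Set (EuclideanSpace ℝ (Fin N))) :
    Set (L2Scalar Ω × (Fin N → L2Scalar Ω)) :=
  {q | ∃ φ : EuclideanSpace ℝ (Fin N) → ℝ, IsTestFunction Ω φ ∧ q.1 =ᵐ[volume.restrict Ω] φ ∧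
    ∀ i, q.2 i =ᵐ[volume.restrict Ω] partialDeriv i φ}

theorem zero_mem_testGradientPairs : (0 : L2Scalar Ω × (Fin N → L2Scalar Ω)) ∈
    testGradientPairs Ω := by
  refine ⟨0, IsTestFunction.zero, Lp.coeFn_zero _ _ _, fun i => ?_⟩
  refine (Lp.coeFn_zero _ _ _).trans (Eventually.of_forall fun x => ?_)
  simp [partialDeriv]

theorem add_mem_testGradientPairs {p q : L2Scalar Ω × (Fin N → L2Scalar Ω)}
    (hp : p ∈ testGradientPairs Ω) (hq : q ∈ testGradientPairs Ω) :
    p + q ∈ testGradientPairs Ω := by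
  obtain ⟨φ, hφ, h1, h2⟩ := hp
  obtain ⟨ψ, hψ, k1, k2⟩ := hq
  refine ⟨φ + ψ, hφ.add hψ, (Lp.coeFn_add _ _).trans (h1.add k1), fun i => ?_⟩
  refine (Lp.coeFn_add _ _).trans (((h2 i).add (k2 i)).trans (Eventually.of_forall fun x => ?_))
  simp only [Pi.add_apply, partialDeriv]
  rw [fderiv_add (hφ.1.differentiable (by simp) x) (hψ.1.differentiable (by simp) x)]
  rfl

theorem smul_mem_testGradientPairs (c : ℝ) {p : L2Scalar Ω × (Fin N → L2Scalar Ω)}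
    (hp : p ∈ testGradientPairs Ω) : c • p ∈ testGradientPairs Ω := by
  obtain ⟨φ, hφ, h1, h2⟩ := hp
  refine ⟨c • φ, hφ.smul c, (Lp.coeFn_smul _ _).trans (h1.const_smul c), fun i => ?_⟩
  refine (Lp.coeFn_smul _ _).trans (((h2 i).const_smul c).trans (Eventually.of_forall fun x => ?_))
  simp only [Pi.smul_apply, partialDeriv]
  rw [fderiv_const_smul (hφ.1.differentiable (by simp) x)]
  rfl

/-- The limit of the gradients along a sequence of test functions is a weak gradient. -/
theorem hasWeakPartial_of_mem_closure {q : L2Scalar Ω × (Fin N → L2Scalar Ω)}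
    (hq : q ∈ closure (testGradientPairs Ω)) (i : Fin N) : HasWeakPartial i q.1 (q.2 i) := by
  rw [hasWeakPartial_iff]
  intro ψ hψ
  refine closure_minimal (t := {q : L2Scalar Ω × (Fin N → L2Scalar Ω) |
    ⟪q.1, (hψ.partialDeriv i).memLp.toLp⟫ = -⟪q.2 i, hψ.memLp.toLp⟫}) ?_
    (isClosed_eq (by fun_prop) (by fun_prop)) hq
  rintro q ⟨φ, hφ, h1, h2⟩
  rw [Set.mem_ofPred_eq, L2Scalar.inner_eq_integral (MemLp.coeFn_toLp hψ.memLp),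
    L2Scalar.inner_eq_integral (MemLp.coeFn_toLp (hψ.partialDeriv i).memLp)]
  have e1 : ∫ x in Ω, q.1 x * partialDeriv i ψ x = ∫ x in Ω, φ x * partialDeriv i ψ x :=
    integral_congr_ae (h1.mono fun x hx => by simp only [hx])
  have e2 : ∫ x in Ω, q.2 i x * ψ x = ∫ x in Ω, partialDeriv i φ x * ψ x :=
    integral_congr_ae ((h2 i).mono fun x hx => by simp only [hx])
  rw [e1, e2, hφ.integral_mul_partialDeriv hψ]

/-- Integration by parts against elements of `H_0^1(Ω)`, by density of the test functions. -/
theorem HasWeakPartial.inner_eq_of_mem_closure {i : Fin N} {u v : L2Scalar Ω}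
    (h : HasWeakPartial i u v) {q : L2Scalar Ω × (Fin N → L2Scalar Ω)}
    (hq : q ∈ closure (testGradientPairs Ω)) : ⟪v, q.1⟫ = -⟪u, q.2 i⟫ := by
  refine closure_minimal (t := {q : L2Scalar Ω × (Fin N → L2Scalar Ω) |
    ⟪v, q.1⟫ = -⟪u, q.2 i⟫}) ?_ (isClosed_eq (by fun_prop) (by fun_prop)) hq
  rintro q ⟨φ, hφ, h1, h2⟩
  rw [Set.mem_ofPred_eq, h.inner_eq hφ h1 (h2 i), neg_neg]

namespace IsDirichletLaplacian

variable {u u' f f' : L2Scalar Ω}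

theorem zero : IsDirichletLaplacian (0 : L2Scalar Ω) 0 :=
  ⟨⟨0, subset_closure zero_mem_testGradientPairs⟩,
    fun _ => ⟨0, HasWeakPartial.zero, fun _ => ⟨0, HasWeakPartial.zero⟩⟩,
    0, 0, fun _ => ⟨HasWeakPartial.zero, HasWeakPartial.zero⟩, by simp⟩

theorem add (h : IsDirichletLaplacian u f) (h' : IsDirichletLaplacian u' f') :
    IsDirichletLaplacian (u + u') (f + f') := by
  obtain ⟨⟨p, hp⟩, h2, g, k, hgk, hf⟩ := h
  obtain ⟨⟨p', hp'⟩, h2', g', k', hgk', hf'⟩ := h'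
  refine ⟨⟨p + p', map_mem_closure₂ (f := fun a b : L2Scalar Ω × (Fin N → L2Scalar Ω) => a + b)
    continuous_add hp hp'
    fun _ ha _ hb => add_mem_testGradientPairs ha hb⟩, fun i => ?_, g + g', k + k', fun i =>
      ⟨(hgk i).1.add (hgk' i).1, (hgk i).2.add (hgk' i).2⟩, ?_⟩
  · obtain ⟨a, ha, hb⟩ := h2 i
    obtain ⟨a', ha', hb'⟩ := h2' i
    refine ⟨a + a', ha.add ha', fun j => ?_⟩
    obtain ⟨b, hb⟩ := hb j
    obtain ⟨b', hb'⟩ := hb' j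
    exact ⟨b + b', hb.add hb'⟩
  · simp only [hf, hf', Pi.add_apply, Finset.sum_add_distrib]

theorem smul (c : ℝ) (h : IsDirichletLaplacian u f) : IsDirichletLaplacian (c • u) (c • f) := by
  obtain ⟨⟨p, hp⟩, h2, g, k, hgk, hf⟩ := h
  refine ⟨⟨c • p, map_mem_closure (f := fun a : L2Scalar Ω × (Fin N → L2Scalar Ω) => c • a)
    (continuous_const_smul c) hp
    fun _ ha => smul_mem_testGradientPairs c ha⟩, fun i => ?_, c • g, c • k, fun i =>
      ⟨(hgk i).1.smul c, (hgk i).2.smul c⟩, ?_⟩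
  · obtain ⟨a, ha, hb⟩ := h2 i
    refine ⟨c • a, ha.smul c, fun j => ?_⟩
    obtain ⟨b, hb⟩ := hb j
    exact ⟨c • b, hb.smul c⟩
  · simp only [hf, Pi.smul_apply, Finset.smul_sum]

theorem sum {ι : Type*} (s : Finset ι) {u f : ι → L2Scalar Ω}
    (h : ∀ i ∈ s, IsDirichletLaplacian (u i) (f i)) :
    IsDirichletLaplacian (∑ i ∈ s, u i) (∑ i ∈ s, f i) := by
  classical
  induction s using Finset.induction_on with
  | empty => simpa using zero
  | insert a s ha ih =>
    rw [Finset.sum_insert ha, Finset.sum_insert ha]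
    exact (h a (by simp)).add (ih fun i hi => h i (by simp [hi]))

/-- Green's identity: `⟪Δu, u'⟫ = -∑ᵢ ⟪∂ᵢu, ∂ᵢu'⟫`, which is symmetric in `u` and `u'`. The
gradient coming from `H_0^1` and the weak gradient agree because weak derivatives are unique. -/
theorem inner_comm (hΩ : IsOpen Ω) (h : IsDirichletLaplacian u f)
    (h' : IsDirichletLaplacian u' f') : ⟪f, u'⟫ = ⟪u, f'⟫ := by
  obtain ⟨⟨p, hp⟩, -, g, k, hgk, hf⟩ := h
  obtain ⟨⟨p', hp'⟩, -, g', k', hgk', hf'⟩ := h'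
  have e : ∀ i, p i = g i := fun i => (hasWeakPartial_of_mem_closure hp i).unique hΩ (hgk i).1
  have e' : ∀ i, p' i = g' i := fun i =>
    (hasWeakPartial_of_mem_closure hp' i).unique hΩ (hgk' i).1
  rw [hf, hf', sum_inner, inner_sum]
  refine Finset.sum_congr rfl fun i _ => ?_
  have h1 := (hgk i).2.inner_eq_of_mem_closure hp'
  have h2 := (hgk' i).2.inner_eq_of_mem_closure hp
  simp only [e, e'] at h1 h2
  rw [h1, real_inner_comm (k' i) u, h2, real_inner_comm (g' i) (g i)]

end IsDirichletLaplacian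

end Sobolev

/-! ### Constant matrices and the componentwise Laplacian -/

section Matrices

open scoped RealInnerProductSpace

variable {N : ℕ} {Ω : Set (EuclideanSpace ℝ (Fin N))} {p q r : ℕ}

theorem coeFn_matrixOp (M : Matrix (Fin p) (Fin q) ℝ) (y : L2Vec Ω q) :
    matrixOp Ω M y =ᵐ[volume.restrict Ω] fun x => WithLp.toLp 2 (M.mulVec (y x).ofLp) :=
  ContinuousLinearMap.coeFn_compLpL _ _

theorem coeFn_component (i : Fin p) (y : L2Vec Ω p) :
    component i y =ᵐ[volume.restrict Ω] fun x => y x i :=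
  ContinuousLinearMap.coeFn_compLp _ _

theorem matrixOp_mul (M : Matrix (Fin p) (Fin q) ℝ) (M' : Matrix (Fin q) (Fin r) ℝ)
    (y : L2Vec Ω r) : matrixOp Ω (M * M') y = matrixOp Ω M (matrixOp Ω M' y) := by
  refine Lp.ext ?_
  filter_upwards [coeFn_matrixOp (M * M') y, coeFn_matrixOp M (matrixOp Ω M' y),
    coeFn_matrixOp M' y] with x h1 h2 h3
  rw [h1, h2, h3, Matrix.mulVec_mulVec]

theorem matrixOp_one (y : L2Vec Ω p) : matrixOp Ω (1 : Matrix (Fin p) (Fin p) ℝ) y = y := by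
  refine Lp.ext ?_
  filter_upwards [coeFn_matrixOp (1 : Matrix (Fin p) (Fin p) ℝ) y] with x h1
  rw [h1, Matrix.one_mulVec]

theorem component_matrixOp (M : Matrix (Fin p) (Fin q) ℝ) (y : L2Vec Ω q) (i : Fin p) :
    component i (matrixOp Ω M y) = ∑ j, M i j • component j y := by
  refine Lp.ext ?_
  have h4 : ∀ᵐ x ∂(volume.restrict Ω), ∀ j, (M i j • component j y : L2Scalar Ω) x =
      M i j * y x j := by
    refine ae_all_iff.2 fun j => ?_
    filter_upwards [Lp.coeFn_smul (M i j) (component j y), coeFn_component j y] with x h1 h2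
    rw [h1, Pi.smul_apply, h2, smul_eq_mul]
  filter_upwards [coeFn_matrixOp M y, coeFn_component i (matrixOp Ω M y), h4,
    Lp.coeFn_finsetSum Finset.univ fun j => M i j • component j y] with x h1 h2 h3 h5
  rw [h2, h1, h5, Finset.sum_apply]
  simp [h3, Matrix.mulVec, dotProduct]

theorem L2Vec.inner_eq_sum (y z : L2Vec Ω p) :
    ⟪y, z⟫ = ∑ i, ⟪component i y, component i z⟫ := by
  simp only [L2.inner_def]
  rw [← integral_finsetSum _ fun i _ => L2.integrable_inner _ _]
  refine integral_congr_ae ?_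
  filter_upwards [ae_all_iff.2 fun i => coeFn_component i y,
    ae_all_iff.2 fun i => coeFn_component i z] with x h1 h2
  simp [PiLp.inner_apply, h1, h2]

/-- The graph of the Dirichlet Laplacian acting componentwise on `L²(Ω; ℝ^p)`. -/
def IsVectorLaplacian (y w : L2Vec Ω p) : Prop :=
  ∀ i, IsDirichletLaplacian (component i y) (component i w)

theorem IsVectorLaplacian.matrixOp {y w : L2Vec Ω q} (h : IsVectorLaplacian y w)
    (M : Matrix (Fin p) (Fin q) ℝ) : IsVectorLaplacian (matrixOp Ω M y) (matrixOp Ω M w) := by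
  intro i
  rw [component_matrixOp, component_matrixOp]
  exact IsDirichletLaplacian.sum _ fun j _ => (h j).smul _

theorem IsVectorLaplacian.inner_comm (hΩ : IsOpen Ω) {y w y' w' : L2Vec Ω p}
    (h : IsVectorLaplacian y w) (h' : IsVectorLaplacian y' w') : ⟪w, y'⟫ = ⟪y, w'⟫ := by
  rw [L2Vec.inner_eq_sum, L2Vec.inner_eq_sum]
  exact Finset.sum_congr rfl fun i _ => (h i).inner_comm hΩ (h' i)

theorem isCoupledLaplacian_iff {A : Matrix (Fin p) (Fin p) ℝ} {y z : L2Vec Ω p} :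
    IsCoupledLaplacian A y z ↔ IsVectorLaplacian y (z - matrixOp Ω A y) := by
  constructor
  · rintro ⟨w, hw, rfl⟩
    rwa [add_sub_cancel_right]
  · exact fun h => ⟨_, h, (sub_add_cancel _ _).symm⟩

end Matrices

/-! ### The reachable space -/

section Reachable

variable {n m : ℕ}

/-- By Cayley–Hamilton the powers `A ^ j` with `j ≥ n` contribute nothing new. -/
theorem pow_mul_mulVec_mem_reachableSpace (hn : 0 < n) (A : Matrix (Fin n) (Fin n) ℝ)
    (B : Matrix (Fin n) (Fin m) ℝ) (j : ℕ) (v : Fin m → ℝ) :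
    (A ^ j * B).mulVec v ∈ reachableSpace A B := by
  have hlt : ∀ i < n, (A ^ i * B).mulVec v ∈ reachableSpace A B := fun i hi => by
    refine ⟨Pi.single ⟨i, hi⟩ v, ?_⟩
    rw [LinearMap.sum_apply, Finset.sum_eq_single ⟨i, hi⟩]
    · simp
    · intro b _ hb
      simp [Pi.single_eq_of_ne hb]
    · simp
  have hdeg : (Polynomial.X ^ j %ₘ A.charpoly).natDegree < n := by
    have h1 := Polynomial.natDegree_modByMonic_lt (Polynomial.X ^ j) A.charpoly_monic fun h => by
      have h2 := A.charpoly_natDegree_eq_dim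
      rw [h, Polynomial.natDegree_one, Fintype.card_fin] at h2
      omega
    rwa [A.charpoly_natDegree_eq_dim, Fintype.card_fin] at h1
  rw [Matrix.pow_eq_aeval_mod_charpoly, Polynomial.aeval_eq_sum_range' hdeg, Matrix.sum_mul,
    Matrix.sum_mulVec]
  refine Submodule.sum_mem _ fun i hi => ?_
  rw [Matrix.smul_mul, Matrix.smul_mulVec]
  exact Submodule.smul_mem _ _ (hlt i (Finset.mem_range.1 hi))

theorem mulVec_mem_reachableSpace (hn : 0 < n) {A : Matrix (Fin n) (Fin n) ℝ}
    {B : Matrix (Fin n) (Fin m) ℝ} {x : Fin n → ℝ} (hx : x ∈ reachableSpace A B) :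
    A.mulVec x ∈ reachableSpace A B := by
  obtain ⟨v, rfl⟩ := hx
  rw [LinearMap.sum_apply, Matrix.mulVec_sum]
  refine Submodule.sum_mem _ fun j _ => ?_
  have := pow_mul_mulVec_mem_reachableSpace hn A B (j + 1) (v j)
  rw [pow_succ', Matrix.mul_assoc] at this
  simpa [Matrix.mulVec_mulVec] using this

theorem exists_matrix_mulVec_eq_zero_iff (V : Submodule ℝ (Fin n → ℝ)) :
    ∃ Q : Matrix (Fin n) (Fin n) ℝ, ∀ x, Q.mulVec x = 0 ↔ x ∈ V := by
  obtain ⟨W, hW⟩ := V.exists_isCompl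
  refine ⟨LinearMap.toMatrix' (W.subtype ∘ₗ W.projectionOnto V hW.symm), fun x => ?_⟩
  rw [LinearMap.toMatrix'_mulVec, LinearMap.comp_apply, Submodule.subtype_apply,
    Submodule.coe_eq_zero, Submodule.projectionOnto_apply_eq_zero_iff]

end Reachable

/-! ### The controllable subspace and the control operator -/

section Controllable

variable {N n m : ℕ} {Ω : Set (EuclideanSpace ℝ (Fin N))} {A : Matrix (Fin n) (Fin n) ℝ}
  {B : Matrix (Fin n) (Fin m) ℝ}

/-- `L²(Ω; ℜ)` is the kernel of a bounded operator; in particular it is a closed subspace. -/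
theorem mem_controllableSubspace_iff {Q : Matrix (Fin n) (Fin n) ℝ}
    (hQ : ∀ x, Q.mulVec x = 0 ↔ x ∈ reachableSpace A B) {y : L2Vec Ω n} :
    y ∈ controllableSubspace Ω A B ↔ matrixOp Ω Q y = 0 := by
  rw [Lp.eq_zero_iff_ae_eq_zero]
  change (∀ᵐ x ∂_, _) ↔ ∀ᵐ x ∂_, _
  refine eventually_congr ?_
  filter_upwards [coeFn_matrixOp Q y] with x hx
  rw [hx, ← hQ, Pi.zero_apply, WithLp.toLp_eq_zero]

theorem matrixOp_mem_controllableSubspace (hn : 0 < n) {y : L2Vec Ω n}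
    (hy : y ∈ controllableSubspace Ω A B) : matrixOp Ω A y ∈ controllableSubspace Ω A B := by
  filter_upwards [hy, coeFn_matrixOp A y] with x h1 h2
  rw [h2]
  exact mulVec_mem_reachableSpace hn h1

open NormedSpace in
/-- Every term of the exponential series is in the closed subspace `L²(Ω; ℜ)`. -/
theorem exp_matrixOp_mem_controllableSubspace (hn : 0 < n) (c : ℝ) {y : L2Vec Ω n}
    (hy : y ∈ controllableSubspace Ω A B) :
    exp (c • matrixOp Ω A) y ∈ controllableSubspace Ω A B := by
  obtain ⟨Q, hQ⟩ := exists_matrix_mulVec_eq_zero_iff (reachableSpace A B)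
  have hpow : ∀ j : ℕ, (matrixOp Ω A ^ j) y ∈ controllableSubspace Ω A B := by
    intro j
    induction j with
    | zero => simpa using hy
    | succ j ih =>
      rw [pow_succ']
      exact matrixOp_mem_controllableSubspace hn ih
  rw [mem_controllableSubspace_iff hQ]
  have h1 := exp_series_hasSum_exp' (𝕂 := ℝ) (c • matrixOp Ω A)
  have h2 := (h1.mapL (ContinuousLinearMap.apply ℝ (L2Vec Ω n) y)).mapL (matrixOp Ω Q)
  refine h2.unique ?_
  convert hasSum_zero with j
  rw [ContinuousLinearMap.apply_apply, smul_pow, smul_smul, smul_apply, map_smul,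
    (mem_controllableSubspace_iff hQ).1 (hpow j), smul_zero]

/-- The truncation `χ_ω v` of `v ∈ L²(Ω; ℝ^m)`. -/
noncomputable def truncate {ω : Set (EuclideanSpace ℝ (Fin N))} (hω : IsOpen ω)
    (v : L2Vec Ω m) : L2Vec Ω m :=
  ((Lp.memLp v).indicator hω.measurableSet).toLp (ω.indicator v)

variable {ω : Set (EuclideanSpace ℝ (Fin N))}

theorem controlOp_eq (hω : IsOpen ω) (v : L2Vec Ω m) :
    controlOp Ω hω B v = matrixOp Ω B (truncate hω v) := by
  refine Lp.ext ?_
  have h1 : controlOp Ω hω B v =ᵐ[volume.restrict Ω] ω.indicator (matrixOp Ω B v) :=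
    MemLp.coeFn_toLp _
  have h2 : truncate hω v =ᵐ[volume.restrict Ω] ω.indicator v := MemLp.coeFn_toLp _
  filter_upwards [h1, h2, coeFn_matrixOp B v, coeFn_matrixOp B (truncate hω v)] with x h1 h2 h3 h4
  rw [h1, h4, h2]
  by_cases hx : x ∈ ω
  · simp [hx, h3]
  · simp [hx]

theorem norm_controlOp_le (hω : IsOpen ω) (v : L2Vec Ω m) :
    ‖controlOp Ω hω B v‖ ≤ ‖matrixOp Ω B‖ * ‖v‖ := by
  rw [controlOp_eq]
  refine (ContinuousLinearMap.le_opNorm _ _).trans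
    (mul_le_mul_of_nonneg_left (Lp.norm_le_norm_of_ae_le ?_) (norm_nonneg _))
  have h2 : truncate hω v =ᵐ[volume.restrict Ω] ω.indicator v := MemLp.coeFn_toLp _
  filter_upwards [h2] with x h2
  rw [h2]
  exact norm_indicator_le_norm_self _ _

theorem controlOp_sub (hω : IsOpen ω) (v w : L2Vec Ω m) :
    controlOp Ω hω B (v - w) = controlOp Ω hω B v - controlOp Ω hω B w := by
  have h : truncate hω (v - w) = truncate hω v - truncate hω w := by
    refine Lp.ext ?_
    have h1 : truncate hω v =ᵐ[volume.restrict Ω] ω.indicator v := MemLp.coeFn_toLp _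
    have h2 : truncate hω w =ᵐ[volume.restrict Ω] ω.indicator w := MemLp.coeFn_toLp _
    have h3 : truncate hω (v - w) =ᵐ[volume.restrict Ω] ω.indicator (v - w : L2Vec Ω m) :=
      MemLp.coeFn_toLp _
    filter_upwards [h1, h2, h3, Lp.coeFn_sub v w, Lp.coeFn_sub (truncate hω v) (truncate hω w)]
      with x h1 h2 h3 h4 h5
    rw [h3, h5, Pi.sub_apply, h1, h2]
    by_cases hx : x ∈ ω
    · simp only [Set.indicator_of_mem hx, h4, Pi.sub_apply]
    · simp [hx]
  rw [controlOp_eq, controlOp_eq, controlOp_eq, h, map_sub]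

theorem continuous_controlOp (hω : IsOpen ω) :
    Continuous (controlOp Ω hω B : L2Vec Ω m → L2Vec Ω n) := by
  refine (LipschitzWith.of_dist_le_mul (K := ‖matrixOp Ω B‖₊) fun v w => ?_).continuous
  rw [dist_eq_norm, dist_eq_norm, ← controlOp_sub, coe_nnnorm]
  exact norm_controlOp_le hω _

theorem controlOp_mem_controllableSubspace (hn : 0 < n) (hω : IsOpen ω) (v : L2Vec Ω m) :
    controlOp Ω hω B v ∈ controllableSubspace Ω A B := by
  rw [controlOp_eq]
  filter_upwards [coeFn_matrixOp B (truncate hω v)] with x h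
  rw [h]
  simpa using pow_mul_mulVec_mem_reachableSpace hn A B 0 (truncate hω v x).ofLp

end Controllable

/-! ### The controlled heat system -/

section HeatSemigroup

variable {N n m : ℕ} {Ω : Set (EuclideanSpace ℝ (Fin N))} {A : Matrix (Fin n) (Fin n) ℝ}
  {B : Matrix (Fin n) (Fin m) ℝ}

/-- The alternative in the definition of `heatSemigroup`; the second case covers the absence of a
generated semigroup. -/
theorem heatSemigroup_cases (Ω : Set (EuclideanSpace ℝ (Fin N))) (A : Matrix (Fin n) (Fin n) ℝ) :
    IsGeneratedBy (heatSemigroup Ω A) (IsCoupledLaplacian A) ∨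
      ∀ t, heatSemigroup Ω A t = ContinuousLinearMap.id ℝ (L2Vec Ω n) := by
  unfold heatSemigroup
  split_ifs with h
  · exact Or.inl h.choose_spec
  · exact Or.inr fun _ => rfl

theorem isC0Semigroup_heatSemigroup (Ω : Set (EuclideanSpace ℝ (Fin N)))
    (A : Matrix (Fin n) (Fin n) ℝ) : IsC0Semigroup (heatSemigroup Ω A) := by
  rcases heatSemigroup_cases Ω A with h | h
  · exact h.1
  · exact ⟨h 0, fun s t _ _ => by simp [h], fun x => by simp [h]⟩

open NormedSpace in
/-- Backward uniqueness modulo `L²(Ω; ℜ)`, through the factorization `S(t) = e^{t𝐀} T(t)` with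
`T` the symmetric semigroup of the componentwise Laplacian. -/
theorem IsGeneratedBy.apply_mem_controllableSubspace_iff (hn : 0 < n) (hΩ : IsOpen Ω)
    {S : ℝ → L2Vec Ω n →L[ℝ] L2Vec Ω n} (hS : IsGeneratedBy S (IsCoupledLaplacian A))
    {t : ℝ} (ht : 0 < t) {y : L2Vec Ω n} :
    S t y ∈ controllableSubspace Ω A B ↔ y ∈ controllableSubspace Ω A B := by
  obtain ⟨Q, hQ⟩ := exists_matrix_mulVec_eq_zero_iff (reachableSpace A B)
  have hG : (IsCoupledLaplacian A : L2Vec Ω n → L2Vec Ω n → Prop) =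
      fun y z => IsVectorLaplacian y (z - matrixOp Ω A y) := by
    ext y z
    exact isCoupledLaplacian_iff
  rw [hG] at hS
  have hT := hS.exp_neg_smul_comp fun y z h => h.matrixOp A
  set T : ℝ → L2Vec Ω n →L[ℝ] L2Vec Ω n := fun t => (exp (-t • matrixOp Ω A)).comp (S t) with hTdef
  have hsymm : ∀ t, 0 ≤ t → ∀ x y, inner ℝ (T t x) y = inner ℝ x (T t y) := fun t ht x y =>
    hT.inner_apply_comm (fun _ _ _ _ h h' => h.inner_comm hΩ h') ht x y
  have hTiff : T t y ∈ controllableSubspace Ω A B ↔ y ∈ controllableSubspace Ω A B := by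
    rw [mem_controllableSubspace_iff hQ, mem_controllableSubspace_iff hQ,
      ← hT.apply_comm (fun y z h => h.matrixOp Q) ht.le]
    exact ⟨hT.1.eq_zero_of_apply_eq_zero hsymm ht, fun h => by rw [h, map_zero]⟩
  rw [← hTiff]
  refine ⟨exp_matrixOp_mem_controllableSubspace hn (-t), fun h => ?_⟩
  let _ : NormedAlgebra ℚ (L2Vec Ω n →L[ℝ] L2Vec Ω n) := NormedAlgebra.restrictScalars ℚ ℝ _
  have e : exp (t • matrixOp Ω A) * exp (-t • matrixOp Ω A) = 1 := by
    rw [← exp_add_of_commute]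
    · simp
    · exact ((Commute.refl _).smul_left _).smul_right _
  have h2 := exp_matrixOp_mem_controllableSubspace hn t h
  rwa [show exp (t • matrixOp Ω A) (T t y) = S t y from
    congrArg (fun L : L2Vec Ω n →L[ℝ] L2Vec Ω n => L (S t y)) e] at h2

/-- Membership in `L²(Ω; ℜ)` neither appears nor disappears along the free evolution. -/
theorem heatSemigroup_mem_controllableSubspace_iff (hn : 0 < n) (hΩ : IsOpen Ω) {t : ℝ}
    (ht : 0 ≤ t) {y : L2Vec Ω n} :
    heatSemigroup Ω A t y ∈ controllableSubspace Ω A B ↔ y ∈ controllableSubspace Ω A B := by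
  rcases ht.eq_or_lt with rfl | ht
  · rw [(isC0Semigroup_heatSemigroup Ω A).zero, ContinuousLinearMap.id_apply]
  rcases heatSemigroup_cases Ω A with h | h
  · exact h.apply_mem_controllableSubspace_iff hn hΩ ht
  · rw [h, ContinuousLinearMap.id_apply]

variable {ω : Set (EuclideanSpace ℝ (Fin N))}

theorem ae_norm_heatSemigroup_controlOp_le (hω : IsOpen ω) {u : ℝ → L2Vec Ω m}
    (hu : IsConstrainedControl u) {t C : ℝ}
    (hC : ∀ r ∈ Set.Icc 0 t, ‖heatSemigroup Ω A r‖ ≤ C) :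
    ∀ᵐ s, s ∈ Set.Ioc 0 t →
      ‖heatSemigroup Ω A (t - s) (controlOp Ω hω B (u s))‖ ≤ C * ‖matrixOp Ω B‖ := by
  filter_upwards [(ae_restrict_iff' measurableSet_Ioi).1 hu.2] with s hus hs
  have hC1 := hC (t - s) ⟨sub_nonneg.2 hs.2, sub_le_self _ hs.1.le⟩
  refine ((heatSemigroup Ω A (t - s)).le_of_opNorm_le hC1 _).trans ?_
  refine mul_le_mul_of_nonneg_left ?_ ((norm_nonneg _).trans hC1)
  exact (norm_controlOp_le hω _).trans (mul_le_of_le_one_right (norm_nonneg _) (hus hs.1))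

/-- The integrand of Duhamel's formula is integrable: it is bounded, and it is measurable because
`(s, x) ↦ e^{(t - s)𝒜} x` is jointly continuous. -/
theorem intervalIntegrable_heatState (hω : IsOpen ω) {u : ℝ → L2Vec Ω m}
    (hu : IsConstrainedControl u) {t : ℝ} (ht : 0 ≤ t) :
    IntervalIntegrable (fun s => heatSemigroup Ω A (t - s) (controlOp Ω hω B (u s)))
      volume 0 t := by
  have hS := isC0Semigroup_heatSemigroup Ω A
  obtain ⟨C, hC⟩ := hS.exists_norm_le t
  -- The semigroup is only controlled at nonnegative times, hence the `max`.
  have hF : Continuous fun q : ℝ × L2Vec Ω n => heatSemigroup Ω A (max (t - q.1) 0) q.2 :=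
    continuous_iff_continuousAt.2 fun q => hS.tendsto_apply (le_max_right _ _)
      (Continuous.tendsto (f := fun q : ℝ × L2Vec Ω n => max (t - q.1) 0) (by fun_prop) q)
      (Eventually.of_forall fun _ => le_max_right _ _) (continuous_snd.tendsto q)
  have hu' : AEStronglyMeasurable u (volume.restrict (Set.Ioc 0 t)) :=
    hu.1.mono_measure (Measure.restrict_mono Set.Ioc_subset_Ioi_self le_rfl)
  have hmeas := hF.comp_aestronglyMeasurable
    ((aestronglyMeasurable_id (μ := volume.restrict (Set.Ioc 0 t))).prodMk
      ((continuous_controlOp (B := B) hω).comp_aestronglyMeasurable hu'))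
  rw [intervalIntegrable_iff_integrableOn_Ioc_of_le ht]
  refine Integrable.of_bound ?_ (C * ‖matrixOp Ω B‖) ?_
  · refine hmeas.congr ?_
    filter_upwards [ae_restrict_mem measurableSet_Ioc] with s hs
    simp [max_eq_left (sub_nonneg.2 hs.2)]
  · exact (ae_restrict_iff' measurableSet_Ioc).2 (ae_norm_heatSemigroup_controlOp_le hω hu hC)

/-- An initial state that can be steered to `0` is in `L²(Ω; ℜ)`. -/
theorem mem_controllableSubspace_of_heatState_eq_zero (hn : 0 < n) (hΩ : IsOpen Ω)
    (hω : IsOpen ω) {y₀ : L2Vec Ω n} {u : ℝ → L2Vec Ω m} {t : ℝ}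
    (hu : IsConstrainedControl u) (ht : 0 ≤ t) (h : heatState Ω hω A B y₀ u t = 0) :
    y₀ ∈ controllableSubspace Ω A B := by
  obtain ⟨Q, hQ⟩ := exists_matrix_mulVec_eq_zero_iff (reachableSpace A B)
  rw [← heatSemigroup_mem_controllableSubspace_iff hn hΩ ht, mem_controllableSubspace_iff hQ,
    eq_neg_of_add_eq_zero_left h, map_neg, neg_eq_zero]
  rw [← ContinuousLinearMap.intervalIntegral_comp_comm _ (intervalIntegrable_heatState hω hu ht)]
  refine intervalIntegral.integral_zero_ae (ae_of_all _ fun s hs => ?_)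
  rw [Set.uIoc_of_le ht] at hs
  rw [← mem_controllableSubspace_iff hQ,
    heatSemigroup_mem_controllableSubspace_iff hn hΩ (sub_nonneg.2 hs.2)]
  exact controlOp_mem_controllableSubspace hn hω _

/-- The state `e^{t𝒜} y₀` is close to `y₀` for small `t`, while a constrained control moves it by
at most a multiple of `t`. -/
theorem exists_pos_forall_heatState_ne_zero (hω : IsOpen ω) {y₀ : L2Vec Ω n} (hy₀ : y₀ ≠ 0) :
    ∃ ε > 0, ∀ t ∈ Set.Ioo 0 ε, ∀ u : ℝ → L2Vec Ω m, IsConstrainedControl u →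
      heatState Ω hω A B y₀ u t ≠ 0 := by
  have hS := isC0Semigroup_heatSemigroup Ω A
  obtain ⟨C, hC⟩ := hS.exists_norm_le 1
  have hpos : 0 < ‖y₀‖ := norm_pos_iff.2 hy₀
  have h1 : ∀ᶠ t in 𝓝[>] (0 : ℝ), C * ‖matrixOp Ω B‖ * t < ‖heatSemigroup Ω A t y₀‖ := by
    refine Tendsto.eventually_lt (y := 0) ?_ (hS.tendsto y₀).norm hpos
    have h2 : Tendsto (fun t : ℝ => C * ‖matrixOp Ω B‖ * t) (𝓝 0) (𝓝 (C * ‖matrixOp Ω B‖ * 0)) :=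
      tendsto_id.const_mul _
    rw [mul_zero] at h2
    exact h2.mono_left nhdsWithin_le_nhds
  obtain ⟨ε, hε, hsub⟩ := mem_nhdsGT_iff_exists_Ioo_subset.1 h1
  refine ⟨min ε 1, lt_min hε one_pos, fun t ht u hu h => ?_⟩
  have hbound : ‖∫ s in (0 : ℝ)..t, heatSemigroup Ω A (t - s) (controlOp Ω hω B (u s))‖ ≤
      C * ‖matrixOp Ω B‖ * |t - 0| := by
    refine intervalIntegral.norm_integral_le_of_norm_le_const_ae ?_
    rw [Set.uIoc_of_le ht.1.le]
    exact ae_norm_heatSemigroup_controlOp_le hω hu fun r hr => hC r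
      ⟨hr.1, hr.2.trans (ht.2.le.trans (min_le_right _ _))⟩
  have h3 : C * ‖matrixOp Ω B‖ * t < ‖heatSemigroup Ω A t y₀‖ :=
    hsub ⟨ht.1, ht.2.trans_le (min_le_left _ _)⟩
  rw [eq_neg_of_add_eq_zero_left h, norm_neg] at h3
  rw [sub_zero, abs_of_pos ht.1] at hbound
  exact absurd hbound (not_le.2 h3)

end HeatSemigroup

/-! ### Kalman coordinates -/

section Kalman

variable {N k n m : ℕ} {Ω : Set (EuclideanSpace ℝ (Fin N))}

/-- The matrix of the projection `ℝ^n → ℝ^k` onto the first `k` coordinates. -/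
noncomputable def headMatrix (hk : k ≤ n) : Matrix (Fin k) (Fin n) ℝ :=
  (1 : Matrix (Fin n) (Fin n) ℝ).submatrix (fun a => blockEquiv hk (Sum.inl a)) id

theorem headMatrix_mulVec (hk : k ≤ n) (w : Fin n → ℝ) (a : Fin k) :
    (headMatrix hk).mulVec w a = w (blockEquiv hk (Sum.inl a)) := by
  simp [headMatrix, Matrix.mulVec, dotProduct, Matrix.one_apply]

theorem matrixOp_headMatrix_padZero (hk : k ≤ n) (y : L2Vec Ω k) :
    matrixOp Ω (headMatrix hk) (padZero hk y) = y := by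
  have h : headMatrix hk * (Matrix.fromRows (1 : Matrix (Fin k) (Fin k) ℝ) 0).submatrix
      (blockEquiv hk).symm id = 1 := by
    ext a b
    simp [headMatrix, Matrix.mul_apply, Matrix.one_apply]
  rw [padZero, ← matrixOp_mul, h, matrixOp_one]

theorem padZero_matrixOp_headMatrix (hk : k ≤ n) {w : L2Vec Ω n}
    (hw : ∀ᵐ x ∂(volume.restrict Ω), ∀ i, w x (blockEquiv hk (Sum.inr i)) = 0) :
    padZero hk (matrixOp Ω (headMatrix hk) w) = w := by
  refine Lp.ext ?_
  rw [padZero]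
  filter_upwards [hw, coeFn_matrixOp (headMatrix hk) w, coeFn_matrixOp
    ((Matrix.fromRows (1 : Matrix (Fin k) (Fin k) ℝ) 0).submatrix (blockEquiv hk).symm id)
    (matrixOp Ω (headMatrix hk) w)] with x h0 h1 h2
  rw [h2, h1]
  ext j
  obtain ⟨j, rfl⟩ := (blockEquiv hk).surjective j
  rcases j with a | i
  · simp [Matrix.mulVec, dotProduct, Matrix.one_apply]
    exact headMatrix_mulVec hk _ a
  · simp [Matrix.mulVec, dotProduct, h0 i]

theorem IsKalmanDecomposition.existsUnique_padZero {hk : k ≤ n} {A : Matrix (Fin n) (Fin n) ℝ}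
    {B : Matrix (Fin n) (Fin m) ℝ} {P : Matrix (Fin n) (Fin n) ℝ}
    {A₁ : Matrix (Fin k) (Fin k) ℝ} {A₂ : Matrix (Fin k) (Fin (n - k)) ℝ}
    {A₃ : Matrix (Fin (n - k)) (Fin (n - k)) ℝ} {B₁ : Matrix (Fin k) (Fin m) ℝ}
    (h : IsKalmanDecomposition hk A B P A₁ A₂ A₃ B₁) {y : L2Vec Ω n}
    (hy : y ∈ controllableSubspace Ω A B) :
    ∃! z : L2Vec Ω k, matrixOp Ω P⁻¹ y = padZero hk z := by
  refine ⟨matrixOp Ω (headMatrix hk) (matrixOp Ω P⁻¹ y),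
    (padZero_matrixOp_headMatrix hk ?_).symm, fun z hz => ?_⟩
  · filter_upwards [hy, coeFn_matrixOp P⁻¹ y] with x h1 h2
    rw [h2]
    exact (Set.ext_iff.1 h.image_eq _).1 ⟨_, h1, rfl⟩
  · simp only [hz, matrixOp_headMatrix_padZero]

end Kalman

/-! ### The optimal time and the steerable initial states -/


theorem corollary2p3 {N n m : ℕ} (hN : 0 < N) (hn : 0 < n) (hm : 0 < m)
    (Ω : Set (EuclideanSpace ℝ (Fin N)))
    (hΩ_open : IsOpen Ω) (hΩ_conn : IsConnected Ω) (hΩ_bdd : Bornology.IsBounded Ω)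
    (hΩ_C2 : HasC2Boundary Ω)
    (ω : Set (EuclideanSpace ℝ (Fin N))) (hω : IsOpen ω) (hω_ne : ω.Nonempty) (hω_sub : ω ⊆ Ω)
    (A : Matrix (Fin n) (Fin n) ℝ) (B : Matrix (Fin n) (Fin m) ℝ) (hB : B ≠ 0)
    (y₀ : L2Vec Ω n) (hy₀ : y₀ ≠ 0)
    (hadm : ∃ u : ℝ → L2Vec Ω m, IsAdmissibleControl Ω hω A B y₀ u) :
    (0 < optimalTime Ω hω A B y₀ ∧ optimalTime Ω hω A B y₀ < ⊤) ∧
    (∀ (k : ℕ) (hk : k ≤ n) (P : Matrix (Fin n) (Fin n) ℝ)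
      (A₁ : Matrix (Fin k) (Fin k) ℝ) (A₂ : Matrix (Fin k) (Fin (n - k)) ℝ)
      (A₃ : Matrix (Fin (n - k)) (Fin (n - k)) ℝ) (B₁ : Matrix (Fin k) (Fin m) ℝ),
      IsKalmanDecomposition hk A B P A₁ A₂ A₃ B₁ →
        ∃! ŷ₀ : L2Vec Ω k, matrixOp Ω P⁻¹ y₀ = padZero hk ŷ₀) ∧
    y₀ ∈ controllableSubspace Ω A B := by
  obtain ⟨u, hu, t, ht, hut⟩ := hadm
  have hy : y₀ ∈ controllableSubspace Ω A B :=
    mem_controllableSubspace_of_heatState_eq_zero hn hΩ_open hω hu ht.le hut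
  refine ⟨⟨?_, ?_⟩, fun k hk P A₁ A₂ A₃ B₁ h => h.existsUnique_padZero hy, hy⟩
  · obtain ⟨ε, hε, hne⟩ := exists_pos_forall_heatState_ne_zero (A := A) (B := B) hω hy₀
    refine lt_of_lt_of_le (EReal.coe_pos.2 hε) (le_sInf ?_)
    rintro _ ⟨s, ⟨hs, v, hv, hsv⟩, rfl⟩
    refine EReal.coe_le_coe_iff.2 (not_lt.1 fun hlt => hne s ⟨hs, hlt⟩ v hv hsv)
  · exact lt_of_le_of_lt (sInf_le ⟨t, ⟨ht, u, hu, hut⟩, rfl⟩) (EReal.coe_lt_top t)
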